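/- Let $d_A,d_B\ge 2$ be integers, $d=\min(d_A,d_B)$, and let $\rho$ be a bipartite state on $\mathbb{C}^{d_A}\otimes\mathbb{C}^{d_B}$, i.e. a positive semidefinite complex matrix of trace one. Let $\mu\in\mathbb{R}^n$ and $\nu\in\mathbb{R}^m$ be arbitrary real column vectors, with Euclidean norms $|\mu|,|\nu|$. Let $\rho_A=\operatorname{Tr}_B\rho$ and $\rho_B=\operatorname{Tr}_A\rho$ be the reduced matrices, let $\operatorname{Vec}$ be the column-stacking vectorization, and let $\mathcal{R}(\rho)$ be the realigned matrix of $\rho$: writing $\rho$ as a $d_A\times d_A$ block matrix with blocks $\rho_{i,j}\in\mathbb{C}^{d_B\times d_B}$, $\mathcal{R}(\rho)$ is the $d_A^2\times d_B^2$ matrix with rows $\operatorname{Vec}(\rho_{1,1})^T,\ldots,\operatorname{Vec}(\rho_{d_A,1})^T,\ldots,\operatorname{Vec}(\rho_{1,d_A})^T,\ldots,\operatorname{Vec}(\rho_{d_A,d_A})^T$. Put $$\mathcal{Q}_{\mu,\nu}(\rho)=\begin{pmatrix}\mu\nu^T & \mu\operatorname{Vec}(\rho_B)^T\\ \operatorname{Vec}(\rho_A)\nu^T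 & \mathcal{R}(\rho)\end{pmatrix}.$$ Write $\|M\|_{\mathrm{Tr}}=\operatorname{Tr}\sqrt{M^\dagger M}$ for the trace norm. For a unit vector $|\varphi\rangle\in\mathbb{C}^{d_A}\otimes\mathbb{C}^{d_B}$ let $C(|\varphi\rangle)=\sqrt{2\bigl(1-\operatorname{Tr}\bigl((\operatorname{Tr}_B|\varphi\rangle\langle\varphi|)^2\bigr)\bigr)}$, and let the concurrence $C(\rho)$ be the minimum (infimum) of $\sum_i p_iC(|\varphi_i\rangle)$ over all finite decompositions $\rho=\sum_i p_i|\varphi_i\rangle\langle\varphi_i|$ with unit vectors $|\varphi_i\rangle$, $p_i\ge 0$ and $\sum_i p_i=1$. Then $$C(\rho)\ \ge\ \frac{\sqrt{2}}{\sqrt{d(d-1)}}\left(\|\mathcal{Q}_{\mu,\nu}(\rho)\|_{\mathrm{Tr}}-\sqrt{(|\mu|^2+1)(|\nu|^2+1)}\right).$$ -/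

import Mathlib

open scoped Matrix MatrixOrder ComplexOrder

noncomputable section

namespace BipartiteState

/-- A density matrix (quantum state): a positive semidefinite matrix of trace one. -/
structure IsDensityMatrix {S : Type*} [Fintype S] (ρ : Matrix S S ℂ) : Prop where
  posSemidef : ρ.PosSemidef
  trace_eq_one : ρ.trace = 1

/-- The trace norm `Tr √(M† M)` of a (possibly rectangular) complex matrix. -/
def traceNorm {R S : Type*} [Fintype R] [Fintype S] [DecidableEq S] (M : Matrix R S ℂ) : ℝ :=
  (Matrix.trace (CFC.sqrt (Mᴴ * M))).re

/-- The reduced matrix `ρ_A = Tr_B ρ`, the partial trace over the second subsystem. -/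
def reducedA {A B : Type*} [Fintype B] (ρ : Matrix (A × B) (A × B) ℂ) : Matrix A A ℂ :=
  Matrix.of fun i j => ∑ k : B, ρ (i, k) (j, k)

/-- The reduced matrix `ρ_B = Tr_A ρ`, the partial trace over the first subsystem. -/
def reducedB {A B : Type*} [Fintype A] (ρ : Matrix (A × B) (A × B) ℂ) : Matrix B B ℂ :=
  Matrix.of fun k l => ∑ i : A, ρ (i, k) (i, l)

/-- The block `Z_{i,j}` of a matrix on `A × B`, seen as a block matrix indexed by `A`. -/
def block {A B : Type*} (Z : Matrix (A × B) (A × B) ℂ) (i j : A) : Matrix B B ℂ :=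
  Matrix.of fun k l => Z (i, k) (j, l)

/-- The realigned matrix `R(Z)`: its rows are the vectors `Vec(Z_{i,j})ᵀ`, listed in the order
of `Vec`. `Matrix.vec` indexes the column-stacking vectorization by pairs (column, row), so the
row with index `(j, i)` is `Vec(Z_{i,j})ᵀ`. -/
def realign {A B : Type*} (Z : Matrix (A × B) (A × B) ℂ) : Matrix (A × A) (B × B) ℂ :=
  Matrix.of fun q => Matrix.vec (block Z q.2 q.1)

/-- A real vector, regarded as a complex one. -/
def toComplex {n : ℕ} (v : EuclideanSpace ℝ (Fin n)) : Fin n → ℂ := fun i => (v i : ℂ)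

/-- The block matrix
`Q_{μ,ν}(ρ) = [ μ νᵀ , μ Vec(ρ_B)ᵀ ; Vec(ρ_A) νᵀ , R(ρ) ]`. -/
def Q {A B : Type*} [Fintype A] [Fintype B] {n m : ℕ}
    (μ : EuclideanSpace ℝ (Fin n)) (ν : EuclideanSpace ℝ (Fin m))
    (ρ : Matrix (A × B) (A × B) ℂ) : Matrix (Fin n ⊕ A × A) (Fin m ⊕ B × B) ℂ :=
  Matrix.fromBlocks
    (Matrix.vecMulVec (toComplex μ) (toComplex ν))
    (Matrix.vecMulVec (toComplex μ) (reducedB ρ).vec)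
    (Matrix.vecMulVec (reducedA ρ).vec (toComplex ν))
    (realign ρ)

/-- The matrix `|φ⟩⟨φ|`. -/
def ketBra {S : Type*} [Fintype S] (φ : EuclideanSpace ℂ S) : Matrix S S ℂ :=
  Matrix.of fun s t => φ s * star (φ t)

/-- The concurrence `√(2 (1 - Tr ρ_A²))` of a pure state `φ`, where `ρ_A = Tr_B |φ⟩⟨φ|`. -/
def pureConcurrence {A B : Type*} [Fintype A] [Fintype B] (φ : EuclideanSpace ℂ (A × B)) : ℝ :=
  √(2 * (1 - (Matrix.trace (reducedA (ketBra φ) * reducedA (ketBra φ))).re))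

/-- `{p_i, φ_i}` is a decomposition of `ρ` into an ensemble of pure states: `ρ = ∑ p_i |φ_i⟩⟨φ_i|`
with unit vectors `φ_i` and probabilities `p_i`. -/
structure IsEnsemble {S : Type*} [Fintype S] (ρ : Matrix S S ℂ) {k : ℕ}
    (p : Fin k → ℝ) (φ : Fin k → EuclideanSpace ℂ S) : Prop where
  nonneg : ∀ i, 0 ≤ p i
  sum_eq_one : ∑ i, p i = 1
  norm_eq_one : ∀ i, ‖φ i‖ = 1
  eq_sum : ρ = ∑ i, (p i : ℂ) • ketBra (φ i)

/-- The concurrence of a mixed state: the infimum of `∑ p_i C(φ_i)` over all finite ensemble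
decompositions of `ρ` into pure states. -/
def concurrence {A B : Type*} [Fintype A] [Fintype B] (ρ : Matrix (A × B) (A × B) ℂ) : ℝ :=
  sInf {c : ℝ | ∃ (k : ℕ) (p : Fin k → ℝ) (φ : Fin k → EuclideanSpace ℂ (A × B)),
    IsEnsemble ρ p φ ∧ c = ∑ i, p i * pureConcurrence (φ i)}

end BipartiteState

end

/-!
By the singular value decomposition, the trace norm of `M` is the largest value of `|∑ⱼ uⱼ† M v̄ⱼ|`
over orthonormal families `u`, `v`. Hence it is subadditive and `x yᵀ` has trace norm at most
`|x| |y|`.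

For a pure state with Schmidt decomposition `φ = ∑ₚ sₚ uₚ ⊗ vₚ`, the reduced matrices are
`∑ₚ sₚ² |uₚ⟩⟨uₚ|` and `∑ₚ sₚ² |vₚ⟩⟨vₚ|`, while the realigned matrix is the sum over all pairs
`(p, q)` of `sₚ s_q Vec(|uₚ⟩⟨u_q|) Vec(|vₚ⟩⟨v_q|)ᵀ`. As `∑ₚ sₚ² = 1`, the matrix `Q` is the sum over
the same pairs of `sₚ s_q` times a rank-one matrix, where `μ` and `ν` enter the diagonal pairs only.
The diagonal pairs contribute at most `√((|μ|² + 1)(|ν|² + 1))` to the trace norm and the others at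
most `∑_{p ≠ q} sₚ s_q ≤ √(d(d - 1)) √(1 - ∑ₚ sₚ⁴) = √(d(d - 1)/2) C(φ)`, by Cauchy–Schwarz. Since
the weights of an ensemble sum to one, `Q(∑ᵢ pᵢ |φᵢ⟩⟨φᵢ|) = ∑ᵢ pᵢ Q(|φᵢ⟩⟨φᵢ|)`, and the bound passes
to every ensemble of a mixed state.
-/

namespace BipartiteState

open Matrix

section Orthonormal

variable {𝕜 : Type*} [RCLike 𝕜]

theorem norm_sum_inner_mul_inner_le {ι E F : Type*} [NormedAddCommGroup E] [InnerProductSpace 𝕜 E]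
    [NormedAddCommGroup F] [InnerProductSpace 𝕜 F] [Fintype ι] {u : ι → E} {v : ι → F}
    (hu : Orthonormal 𝕜 u) (hv : Orthonormal 𝕜 v) (x : E) (y : F) :
    ‖∑ j, inner 𝕜 (u j) x * inner 𝕜 (v j) y‖ ≤ ‖x‖ * ‖y‖ := by
  calc ‖∑ j, inner 𝕜 (u j) x * inner 𝕜 (v j) y‖
      ≤ ∑ j, ‖inner 𝕜 (u j) x‖ * ‖inner 𝕜 (v j) y‖ := by
        simpa only [norm_mul] using
          norm_sum_le Finset.univ fun j => inner 𝕜 (u j) x * inner 𝕜 (v j) y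
    _ ≤ √(∑ j, ‖inner 𝕜 (u j) x‖ ^ 2) * √(∑ j, ‖inner 𝕜 (v j) y‖ ^ 2) :=
        Real.sum_mul_le_sqrt_mul_sqrt _ _ _
    _ ≤ ‖x‖ * ‖y‖ := by
        gcongr
        · exact Real.sqrt_le_left (norm_nonneg _) |>.mpr (hu.sum_inner_products_le x)
        · exact Real.sqrt_le_left (norm_nonneg _) |>.mpr (hv.sum_inner_products_le y)

variable {ι S : Type*} [Fintype S]

theorem dotProduct_star_of_orthonormal [DecidableEq ι] {v : ι → EuclideanSpace 𝕜 S}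
    (hv : Orthonormal 𝕜 v) (i j : ι) :
    (v i).ofLp ⬝ᵥ star (v j).ofLp = if i = j then 1 else 0 := by
  simpa only [EuclideanSpace.inner_eq_star_dotProduct, eq_comm] using
    orthonormal_iff_ite.mp hv j i

theorem star_dotProduct_of_orthonormal [DecidableEq ι] {v : ι → EuclideanSpace 𝕜 S}
    (hv : Orthonormal 𝕜 v) (i j : ι) :
    star (v i).ofLp ⬝ᵥ (v j).ofLp = if i = j then 1 else 0 := by
  rw [dotProduct_comm, dotProduct_star_of_orthonormal hv]
  simp only [eq_comm]

theorem orthonormal_star {v : ι → EuclideanSpace 𝕜 S} (hv : Orthonormal 𝕜 v) :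
    Orthonormal 𝕜 fun i => (WithLp.toLp 2 (star (v i).ofLp) : EuclideanSpace 𝕜 S) := by
  classical
  refine orthonormal_iff_ite.mpr fun i j => ?_
  rw [EuclideanSpace.inner_eq_star_dotProduct, star_star, star_dotProduct_of_orthonormal hv]
  simp only [eq_comm]

theorem sum_vecMulVec_star_orthonormalBasis [Fintype ι] [DecidableEq S]
    (e : OrthonormalBasis ι 𝕜 (EuclideanSpace 𝕜 S)) :
    ∑ i, vecMulVec (e i).ofLp (star (e i).ofLp) = 1 := by
  have h := congrArg (fun f : EuclideanSpace 𝕜 S →L[𝕜] EuclideanSpace 𝕜 S =>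
    toEuclideanLin.symm f.toLinearMap) e.sum_rankOne_eq_id
  simpa [InnerProductSpace.symm_toEuclideanLin_rankOne] using h

theorem sum_vecMulVec_mul_sum_vecMulVec [Fintype ι] [DecidableEq ι] {α R T : Type*}
    [CommSemiring α] (a b : ι → α) (x : ι → R → α) {v w : ι → S → α} (y : ι → T → α)
    (hvw : ∀ i j, v i ⬝ᵥ w j = if i = j then 1 else 0) :
    (∑ i, a i • vecMulVec (x i) (v i)) * ∑ j, b j • vecMulVec (w j) (y j)
      = ∑ i, (a i * b i) • vecMulVec (x i) (y i) := by
  have product (i j : ι) : vecMulVec (x i) (v i) * vecMulVec (w j) (y j)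
      = if i = j then vecMulVec (x i) (y j) else 0 := by
    rw [vecMulVec_mul_vecMulVec, hvw, vecMulVec_smul, ite_smul, one_smul, zero_smul]
  simp only [Matrix.sum_mul, Matrix.mul_sum, Matrix.smul_mul, Matrix.mul_smul, product, smul_ite,
    smul_zero, smul_smul, Finset.sum_ite_eq', Finset.mem_univ, if_true, mul_comm]

end Orthonormal

section SVD

/-- A singular value (or Schmidt) decomposition `M = ∑ sᵢ uᵢ vᵢᵀ`. The right factors are transposed
rather than conjugate-transposed, so that the `vᵢ` are the Schmidt vectors of the second subsystem
when `M` is the coefficient matrix of a bipartite vector. -/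
structure IsSVD {ι R S : Type*} [Fintype ι] [Fintype R] [Fintype S] (M : Matrix R S ℂ)
    (s : ι → ℝ) (u : ι → EuclideanSpace ℂ R) (v : ι → EuclideanSpace ℂ S) : Prop where
  nonneg : ∀ i, 0 ≤ s i
  orthonormal_left : Orthonormal ℂ u
  orthonormal_right : Orthonormal ℂ v
  eq_sum : M = ∑ i, (s i : ℂ) • vecMulVec (u i).ofLp (v i).ofLp

variable {ι R S : Type*} [Fintype ι] [Fintype R] [Fintype S] {M : Matrix R S ℂ} {s : ι → ℝ}
  {u : ι → EuclideanSpace ℂ R} {v : ι → EuclideanSpace ℂ S}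

theorem inner_mulVec_eigenvectorBasis_of_ne [DecidableEq S] (M : Matrix R S ℂ) {i j : S}
    (hij : i ≠ j) :
    let e := (isHermitian_conjTranspose_mul_self M).eigenvectorBasis
    inner ℂ (WithLp.toLp 2 (M *ᵥ (e i).ofLp)) (WithLp.toLp 2 (M *ᵥ (e j).ofLp)) = 0 := by
  intro e
  rw [EuclideanSpace.inner_eq_star_dotProduct, star_mulVec, dotProduct_comm, ← dotProduct_mulVec,
    mulVec_mulVec, IsHermitian.mulVec_eigenvectorBasis, dotProduct_smul,
    star_dotProduct_of_orthonormal e.orthonormal, if_neg hij, smul_zero]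

theorem exists_isSVD (M : Matrix R S ℂ) :
    ∃ (r : ℕ) (s : Fin r → ℝ) (u : Fin r → EuclideanSpace ℂ R) (v : Fin r → EuclideanSpace ℂ S),
      IsSVD M s u v := by
  classical
  set e := (isHermitian_conjTranspose_mul_self M).eigenvectorBasis
  -- The vectors `M eⱼ` are pairwise orthogonal: the nonzero ones, normalized, are the left factors.
  let g : S → EuclideanSpace ℂ R := fun j => WithLp.toLp 2 (M *ᵥ (e j).ofLp)
  let σ := Fintype.equivFin {j // g j ≠ 0}
  have normalize (j : S) : ((‖g j‖ : ℝ) : ℂ) • ((‖g j‖ : ℝ) : ℂ)⁻¹ • g j = g j := by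
    rcases eq_or_ne (g j) 0 with h | h
    · simp [h]
    · exact smul_inv_smul₀ (by simpa using h) _
  refine ⟨_, fun i => ‖g (σ.symm i)‖, fun i => ((‖g (σ.symm i)‖ : ℝ) : ℂ)⁻¹ • g (σ.symm i),
    fun i => WithLp.toLp 2 (star (e (σ.symm i)).ofLp), fun i => norm_nonneg _, ⟨?_, ?_⟩, ?_, ?_⟩
  · intro i
    exact norm_smul_inv_norm (σ.symm i).2
  · intro i j hij
    rw [inner_smul_left, inner_smul_right, inner_mulVec_eigenvectorBasis_of_ne M
      (Subtype.coe_injective.ne (σ.symm.injective.ne hij)), mul_zero, mul_zero]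
  · exact (orthonormal_star e.orthonormal).comp _
      (Subtype.coe_injective.comp σ.symm.injective)
  · calc M = ∑ j, vecMulVec (g j).ofLp (star (e j).ofLp) := by
          simp only [g, ← mul_vecMulVec, ← Matrix.mul_sum, sum_vecMulVec_star_orthonormalBasis,
            Matrix.mul_one]
      _ = ∑ j : {j // g j ≠ 0}, vecMulVec (g j).ofLp (star (e j).ofLp) := by
          rw [← Finset.sum_subtype (Finset.univ.filter fun j => g j ≠ 0) (by simp)
            fun j => vecMulVec (g j).ofLp (star (e j).ofLp), Finset.sum_filter_of_ne]
          intro j _ hj hgj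
          rw [hgj, WithLp.ofLp_zero, zero_vecMulVec] at hj
          exact hj rfl
      _ = _ := by
          rw [← σ.symm.sum_comp]
          refine Finset.sum_congr rfl fun i _ => ?_
          rw [← smul_vecMulVec, ← WithLp.ofLp_smul, normalize]

namespace IsSVD

theorem card_le (h : IsSVD M s u v) :
    Fintype.card ι ≤ min (Fintype.card R) (Fintype.card S) := by
  refine le_min ?_ ?_
  · simpa using h.orthonormal_left.linearIndependent.fintype_card_le_finrank
  · simpa using h.orthonormal_right.linearIndependent.fintype_card_le_finrank

theorem transpose (h : IsSVD M s u v) : IsSVD Mᵀ s v u where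
  nonneg := h.nonneg
  orthonormal_left := h.orthonormal_right
  orthonormal_right := h.orthonormal_left
  eq_sum := by
    simp only [h.eq_sum, transpose_sum, transpose_smul, transpose_vecMulVec]

theorem conjTranspose_eq_sum (h : IsSVD M s u v) :
    Mᴴ = ∑ i, (s i : ℂ) • vecMulVec (star (v i).ofLp) (star (u i).ofLp) := by
  simp only [h.eq_sum, conjTranspose_sum, conjTranspose_smul, conjTranspose_vecMulVec,
    Complex.star_def, Complex.conj_ofReal]

theorem mul_conjTranspose (h : IsSVD M s u v) :
    M * Mᴴ = ∑ i, ((s i : ℂ) ^ 2) • vecMulVec (u i).ofLp (star (u i).ofLp) := by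
  classical
  rw [h.conjTranspose_eq_sum, h.eq_sum, sum_vecMulVec_mul_sum_vecMulVec _ _ _ _
    (dotProduct_star_of_orthonormal h.orthonormal_right)]
  simp only [sq]

theorem conjTranspose_mul (h : IsSVD M s u v) :
    Mᴴ * M = ∑ i, ((s i : ℂ) ^ 2) • vecMulVec (star (v i).ofLp) (v i).ofLp := by
  classical
  rw [h.conjTranspose_eq_sum, h.eq_sum, sum_vecMulVec_mul_sum_vecMulVec _ _ _ _
    (star_dotProduct_of_orthonormal h.orthonormal_left)]
  simp only [sq]

theorem trace_mul_conjTranspose (h : IsSVD M s u v) :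
    (M * Mᴴ).trace = ∑ i, (s i : ℂ) ^ 2 := by
  classical
  simp only [h.mul_conjTranspose, trace_sum, trace_smul, trace_vecMulVec,
    dotProduct_star_of_orthonormal h.orthonormal_left, if_true, smul_eq_mul, mul_one]

theorem trace_mul_conjTranspose_sq (h : IsSVD M s u v) :
    (M * Mᴴ * (M * Mᴴ)).trace = ∑ i, (s i : ℂ) ^ 4 := by
  classical
  rw [h.mul_conjTranspose, sum_vecMulVec_mul_sum_vecMulVec _ _ _ _
    (star_dotProduct_of_orthonormal h.orthonormal_left)]
  simp only [trace_sum, trace_smul, trace_vecMulVec,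
    dotProduct_star_of_orthonormal h.orthonormal_left, if_true, smul_eq_mul, mul_one,
    ← pow_add]

theorem mulVec_star_right (h : IsSVD M s u v) (j : ι) :
    M *ᵥ star (v j).ofLp = (s j : ℂ) • (u j).ofLp := by
  classical
  simp [h.eq_sum, sum_mulVec, smul_mulVec, vecMulVec_mulVec,
    dotProduct_star_of_orthonormal h.orthonormal_right]

theorem traceNorm_eq [DecidableEq S] (h : IsSVD M s u v) : traceNorm M = ∑ i, s i := by
  classical
  set P : Matrix S S ℂ := ∑ i, (s i : ℂ) • vecMulVec (star (v i).ofLp) (v i).ofLp with hP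
  have P_sq : P * P = Mᴴ * M := by
    rw [h.conjTranspose_mul, hP, sum_vecMulVec_mul_sum_vecMulVec _ _ _ _
      (dotProduct_star_of_orthonormal h.orthonormal_right)]
    simp only [sq]
  have P_nonneg : 0 ≤ P := Finset.sum_nonneg fun i _ =>
    ((posSemidef_vecMulVec_star_self _).smul (Complex.zero_le_real.mpr (h.nonneg i))).nonneg
  rw [traceNorm, CFC.sqrt_unique P_sq P_nonneg]
  simp [hP, trace_sum, trace_vecMulVec, star_dotProduct_of_orthonormal h.orthonormal_right]

end IsSVD

end SVD

section TraceNorm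

variable {ι κ R S : Type*} [Fintype ι] [Fintype R] [Fintype S]
  {u : ι → EuclideanSpace ℂ R} {v : ι → EuclideanSpace ℂ S}

/-- The functional `M ↦ ∑ⱼ uⱼ† M v̄ⱼ` on matrices. The trace norm of `M` is its largest modulus over
all pairs of orthonormal families. -/
def pairing (u : ι → EuclideanSpace ℂ R) (v : ι → EuclideanSpace ℂ S) :
    Matrix R S ℂ →ₗ[ℂ] ℂ where
  toFun M := ∑ j, star (u j).ofLp ⬝ᵥ M *ᵥ star (v j).ofLp
  map_add' M N := by simp only [add_mulVec, dotProduct_add, Finset.sum_add_distrib]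
  map_smul' c M := by
    simp only [smul_mulVec, dotProduct_smul, Finset.smul_sum, RingHom.id_apply]

theorem pairing_vecMulVec (u : ι → EuclideanSpace ℂ R) (v : ι → EuclideanSpace ℂ S)
    (x : EuclideanSpace ℂ R) (y : EuclideanSpace ℂ S) :
    pairing u v (vecMulVec x.ofLp y.ofLp) = ∑ j, inner ℂ (u j) x * inner ℂ (v j) y := by
  refine Finset.sum_congr rfl fun j _ => ?_
  simp [vecMulVec_mulVec, EuclideanSpace.inner_eq_star_dotProduct, dotProduct_comm, mul_comm]

theorem norm_pairing_vecMulVec_le (hu : Orthonormal ℂ u) (hv : Orthonormal ℂ v)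
    (x : EuclideanSpace ℂ R) (y : EuclideanSpace ℂ S) :
    ‖pairing u v (vecMulVec x.ofLp y.ofLp)‖ ≤ ‖x‖ * ‖y‖ := by
  rw [pairing_vecMulVec]
  exact norm_sum_inner_mul_inner_le hu hv x y

variable [DecidableEq S]

theorem exists_pairing_eq_traceNorm (M : Matrix R S ℂ) :
    ∃ (r : ℕ) (u : Fin r → EuclideanSpace ℂ R) (v : Fin r → EuclideanSpace ℂ S),
      Orthonormal ℂ u ∧ Orthonormal ℂ v ∧ pairing u v M = traceNorm M := by
  obtain ⟨r, s, u, v, h⟩ := exists_isSVD M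
  refine ⟨r, u, v, h.orthonormal_left, h.orthonormal_right, ?_⟩
  simp [pairing, h.traceNorm_eq, h.mulVec_star_right,
    star_dotProduct_of_orthonormal h.orthonormal_left]

theorem traceNorm_nonneg (M : Matrix R S ℂ) : 0 ≤ traceNorm M := by
  obtain ⟨r, s, u, v, h⟩ := exists_isSVD M
  exact h.traceNorm_eq ▸ Finset.sum_nonneg fun i _ => h.nonneg i

theorem norm_pairing_le_traceNorm (hu : Orthonormal ℂ u) (hv : Orthonormal ℂ v)
    (M : Matrix R S ℂ) : ‖pairing u v M‖ ≤ traceNorm M := by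
  obtain ⟨r, s, x, y, h⟩ := exists_isSVD M
  calc ‖pairing u v M‖ = ‖∑ i, (s i : ℂ) • pairing u v (vecMulVec (x i).ofLp (y i).ofLp)‖ := by
        simp only [h.eq_sum, map_sum, map_smul]
    _ ≤ ∑ i, s i := norm_sum_le_of_le _ fun i _ => by
        rw [norm_smul, Complex.norm_of_nonneg (h.nonneg i)]
        refine mul_le_of_le_one_right (h.nonneg i) ?_
        simpa only [h.orthonormal_left.1, h.orthonormal_right.1, mul_one] using
          norm_pairing_vecMulVec_le hu hv (x i) (y i)
    _ = traceNorm M := h.traceNorm_eq.symm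

theorem traceNorm_vecMulVec_le (x : EuclideanSpace ℂ R) (y : EuclideanSpace ℂ S) :
    traceNorm (vecMulVec x.ofLp y.ofLp) ≤ ‖x‖ * ‖y‖ := by
  obtain ⟨r, u, v, hu, hv, h⟩ := exists_pairing_eq_traceNorm (vecMulVec x.ofLp y.ofLp)
  rw [← Complex.norm_of_nonneg (traceNorm_nonneg _), ← h]
  exact norm_pairing_vecMulVec_le hu hv x y

theorem traceNorm_sum_smul_le (t : Finset κ) (c : κ → ℂ) (M : κ → Matrix R S ℂ) :
    traceNorm (∑ i ∈ t, c i • M i) ≤ ∑ i ∈ t, ‖c i‖ * traceNorm (M i) := by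
  obtain ⟨r, u, v, hu, hv, h⟩ := exists_pairing_eq_traceNorm (∑ i ∈ t, c i • M i)
  rw [← Complex.norm_of_nonneg (traceNorm_nonneg _), ← h]
  simp only [map_sum, map_smul]
  refine norm_sum_le_of_le _ fun i _ => ?_
  rw [norm_smul]
  gcongr
  exact norm_pairing_le_traceNorm hu hv (M i)

end TraceNorm

section OffDiag

variable {ι : Type*} [Fintype ι]

theorem sum_diag_add_sum_offDiag {α : Type*} [AddCommMonoid α] (f : ι × ι → α) :
    ∑ i, f (i, i) + ∑ x ∈ (Finset.univ : Finset ι).offDiag, f x = ∑ x, f x := by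
  classical
  rw [← Finset.univ_product_univ, ← Finset.diag_union_offDiag,
    Finset.sum_union (Finset.disjoint_diag_offDiag _), Finset.sum_diag]

theorem sum_offDiag_mul {α : Type*} [CommRing α] (f : ι → α) :
    ∑ x ∈ (Finset.univ : Finset ι).offDiag, f x.1 * f x.2 = (∑ i, f i) ^ 2 - ∑ i, f i ^ 2 := by
  rw [sq, Finset.sum_mul_sum, ← Fintype.sum_prod_type', ← sum_diag_add_sum_offDiag]
  simp only [sq, add_sub_cancel_left]

theorem sum_offDiag_mul_le (s : ι → ℝ) {d : ℕ} (hd : Fintype.card ι ≤ d) :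
    ∑ x ∈ (Finset.univ : Finset ι).offDiag, s x.1 * s x.2
      ≤ √(d * (d - 1)) * √((∑ i, s i ^ 2) ^ 2 - ∑ i, s i ^ 4) := by
  have card_le : ((Finset.univ : Finset ι).offDiag.card : ℝ) ≤ d * (d - 1) := by
    have card_le_nat : (Finset.univ : Finset ι).offDiag.card ≤ d * d - d := by
      rw [Finset.offDiag_card, Finset.card_univ, ← Nat.mul_sub_one, ← Nat.mul_sub_one]
      gcongr
    rw [mul_sub_one, ← Nat.cast_mul, ← Nat.cast_sub (Nat.le_mul_self d)]
    exact_mod_cast card_le_nat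
  have sum_sq : ∑ x ∈ (Finset.univ : Finset ι).offDiag, (s x.1 * s x.2) ^ 2
      = (∑ i, s i ^ 2) ^ 2 - ∑ i, s i ^ 4 := by
    simp only [mul_pow]
    rw [sum_offDiag_mul fun i => s i ^ 2]
    simp only [← pow_mul]
  rw [← sum_sq, ← Real.sqrt_mul ((Nat.cast_nonneg _).trans card_le)]
  refine Real.le_sqrt_of_sq_le (sq_sum_le_card_mul_sum_sq.trans ?_)
  gcongr

end OffDiag

section PureState

variable {A B ι κ J : Type*} [Fintype A] [Fintype B] [Fintype J]

/-- The matrix `Q_{w,z}(Z)` for complex vectors `w`, `z` over arbitrary index types. -/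
def complexQ (w : EuclideanSpace ℂ ι) (z : EuclideanSpace ℂ κ) (Z : Matrix (A × B) (A × B) ℂ) :
    Matrix (ι ⊕ A × A) (κ ⊕ B × B) ℂ :=
  fromBlocks
    (vecMulVec w.ofLp z.ofLp)
    (vecMulVec w.ofLp (reducedB Z).vec)
    (vecMulVec (reducedA Z).vec z.ofLp)
    (realign Z)

theorem complexQ_sum_smul (w : EuclideanSpace ℂ ι) (z : EuclideanSpace ℂ κ) {c : J → ℂ}
    (hc : ∑ i, c i = 1) (Z : J → Matrix (A × B) (A × B) ℂ) :
    complexQ w z (∑ i, c i • Z i) = ∑ i, c i • complexQ w z (Z i) := by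
  ext (r | r) (t | t) <;>
    simp only [complexQ, Matrix.sum_apply, Matrix.smul_apply, fromBlocks_apply₁₁,
      fromBlocks_apply₁₂, fromBlocks_apply₂₁, fromBlocks_apply₂₂, vecMulVec_apply, vec, realign,
      block, reducedA, reducedB, of_apply, smul_eq_mul]
  · rw [← Finset.sum_mul, hc, one_mul]
  · rw [Finset.sum_comm, Finset.mul_sum]
    exact Finset.sum_congr rfl fun i _ => by rw [← Finset.mul_sum, mul_left_comm]
  · rw [Finset.sum_comm, Finset.sum_mul]
    exact Finset.sum_congr rfl fun i _ => by rw [← Finset.mul_sum, mul_assoc]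

/-- The direct sum of `w` and `Vec(|x⟩⟨y|)`. -/
def appendVecKetBra {S : Type*} (w : EuclideanSpace ℂ ι) (x y : EuclideanSpace ℂ S) :
    EuclideanSpace ℂ (ι ⊕ S × S) :=
  WithLp.toLp 2 (Sum.elim w.ofLp (vecMulVec x.ofLp (star y.ofLp)).vec)

theorem norm_appendVecKetBra [Fintype ι] {S : Type*} [Fintype S] (w : EuclideanSpace ℂ ι)
    (x y : EuclideanSpace ℂ S) :
    ‖appendVecKetBra w x y‖ = √(‖w‖ ^ 2 + (‖x‖ * ‖y‖) ^ 2) := by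
  rw [EuclideanSpace.norm_eq, Fintype.sum_sum_type, Fintype.sum_prod_type_right, mul_pow,
    EuclideanSpace.norm_sq_eq, EuclideanSpace.norm_sq_eq, EuclideanSpace.norm_sq_eq,
    Finset.sum_mul_sum]
  simp [appendVecKetBra, vec, vecMulVec_apply, mul_pow]

/-- The coefficient matrix of a bipartite vector; its singular value decompositions are the Schmidt
decompositions of the vector. -/
def coeffMatrix (φ : EuclideanSpace ℂ (A × B)) : Matrix A B ℂ :=
  of fun a b => φ (a, b)

variable {φ : EuclideanSpace ℂ (A × B)}

theorem reducedA_ketBra (φ : EuclideanSpace ℂ (A × B)) :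
    reducedA (ketBra φ) = coeffMatrix φ * (coeffMatrix φ)ᴴ := rfl

theorem reducedB_ketBra (φ : EuclideanSpace ℂ (A × B)) :
    reducedB (ketBra φ) = (coeffMatrix φ)ᵀ * (coeffMatrix φ)ᵀᴴ := rfl

theorem trace_reducedA_ketBra (φ : EuclideanSpace ℂ (A × B)) :
    (reducedA (ketBra φ)).trace = ((‖φ‖ ^ 2 : ℝ) : ℂ) := by
  rw [EuclideanSpace.norm_sq_eq, Fintype.sum_prod_type]
  simp [Matrix.trace, reducedA, ketBra, Complex.mul_conj, Complex.normSq_eq_norm_sq]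

variable {s : J → ℝ} {u : J → EuclideanSpace ℂ A} {v : J → EuclideanSpace ℂ B}

theorem sum_sq_schmidt (h : IsSVD (coeffMatrix φ) s u v) : ∑ i, s i ^ 2 = ‖φ‖ ^ 2 := by
  have := h.trace_mul_conjTranspose
  rw [← reducedA_ketBra, trace_reducedA_ketBra] at this
  exact_mod_cast this.symm

theorem pureConcurrence_eq (h : IsSVD (coeffMatrix φ) s u v) :
    pureConcurrence φ = √2 * √(1 - ∑ i, s i ^ 4) := by
  rw [pureConcurrence, reducedA_ketBra, h.trace_mul_conjTranspose_sq]
  norm_cast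
  rw [Real.sqrt_mul zero_le_two]

theorem realign_ketBra (h : IsSVD (coeffMatrix φ) s u v) :
    realign (ketBra φ) = ∑ x : J × J, ((s x.1 : ℂ) * s x.2) •
      vecMulVec (vecMulVec (u x.1).ofLp (star (u x.2).ofLp)).vec
        (vecMulVec (v x.1).ofLp (star (v x.2).ofLp)).vec := by
  have hφ (a : A) (b : B) : φ (a, b) = ∑ i, s i * (u i a * v i b) := by
    simpa [coeffMatrix, Matrix.sum_apply, vecMulVec_apply] using congrFun₂ h.eq_sum a b
  ext ⟨j, i⟩ ⟨l, k⟩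
  simp only [realign, block, ketBra, of_apply, vec, hφ, star_sum, Finset.sum_mul_sum,
    Fintype.sum_prod_type, Matrix.sum_apply, Matrix.smul_apply, vecMulVec_apply, Pi.star_apply,
    smul_eq_mul, star_mul', Complex.star_def, Complex.conj_ofReal]
  exact Finset.sum_congr rfl fun p _ => Finset.sum_congr rfl fun q _ => by ring

theorem complexQ_ketBra [DecidableEq J] (w : EuclideanSpace ℂ ι) (z : EuclideanSpace ℂ κ)
    (hφ : ‖φ‖ = 1) (h : IsSVD (coeffMatrix φ) s u v) :
    complexQ w z (ketBra φ) = ∑ x : J × J, ((s x.1 : ℂ) * s x.2) • vecMulVec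
      (appendVecKetBra (if x.1 = x.2 then w else 0) (u x.1) (u x.2)).ofLp
      (appendVecKetBra (if x.1 = x.2 then z else 0) (v x.1) (v x.2)).ofLp := by
  have sum_sq : ∑ i, (s i : ℂ) * s i = 1 := by
    have := sum_sq_schmidt h
    rw [hφ, one_pow] at this
    simp only [← sq]
    exact_mod_cast this
  rw [complexQ, reducedA_ketBra, reducedB_ketBra, h.mul_conjTranspose,
    h.transpose.mul_conjTranspose, realign_ketBra h]
  ext (r | r) (t | t) <;>
    simp only [fromBlocks_apply₁₁, fromBlocks_apply₁₂, fromBlocks_apply₂₁, fromBlocks_apply₂₂,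
      Matrix.sum_apply, Matrix.smul_apply, vecMulVec_apply, appendVecKetBra, Sum.elim_inl,
      Sum.elim_inr, Fintype.sum_prod_type]
  · simp [apply_ite, ite_apply, ← Finset.sum_mul, sum_sq]
  · simp [apply_ite, ite_apply, Matrix.sum_apply, Finset.mul_sum, sq, mul_left_comm]
  · simp [apply_ite, ite_apply, Matrix.sum_apply, Finset.sum_mul, sq, mul_assoc]

theorem traceNorm_complexQ_ketBra_le [Fintype ι] [Fintype κ] [DecidableEq κ] [DecidableEq B]
    (w : EuclideanSpace ℂ ι) (z : EuclideanSpace ℂ κ) (hφ : ‖φ‖ = 1) {d : ℕ}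
    (hd : min (Fintype.card A) (Fintype.card B) ≤ d) :
    traceNorm (complexQ w z (ketBra φ))
      ≤ √((‖w‖ ^ 2 + 1) * (‖z‖ ^ 2 + 1)) + √(d * (d - 1)) / √2 * pureConcurrence φ := by
  obtain ⟨r, s, u, v, h⟩ := exists_isSVD (coeffMatrix φ)
  have sum_sq : ∑ i, s i ^ 2 = 1 := by rw [sum_sq_schmidt h, hφ, one_pow]
  rw [complexQ_ketBra w z hφ h]
  calc _ ≤ ∑ x : Fin r × Fin r, s x.1 * s x.2 *
        √(((if x.1 = x.2 then ‖w‖ ^ 2 else 0) + 1) * ((if x.1 = x.2 then ‖z‖ ^ 2 else 0) + 1)) := by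
        refine (traceNorm_sum_smul_le _ _ _).trans (Finset.sum_le_sum fun x _ => ?_)
        have coeff_nonneg := mul_nonneg (h.nonneg x.1) (h.nonneg x.2)
        rw [← Complex.ofReal_mul, Complex.norm_of_nonneg coeff_nonneg]
        gcongr
        refine (traceNorm_vecMulVec_le _ _).trans_eq ?_
        rw [Real.sqrt_mul (by positivity)]
        simp only [norm_appendVecKetBra, h.orthonormal_left.1, h.orthonormal_right.1]
        split_ifs <;> simp
    _ = √((‖w‖ ^ 2 + 1) * (‖z‖ ^ 2 + 1)) +
          ∑ x ∈ (Finset.univ : Finset (Fin r)).offDiag, s x.1 * s x.2 := by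
        rw [← sum_diag_add_sum_offDiag]
        congr 1
        · simp only [if_true, ← Finset.sum_mul, ← sq, sum_sq, one_mul]
        · refine Finset.sum_congr rfl fun x hx => ?_
          simp [(Finset.mem_offDiag.mp hx).2.2]
    _ ≤ √((‖w‖ ^ 2 + 1) * (‖z‖ ^ 2 + 1)) +
          √(d * (d - 1)) * √((∑ i, s i ^ 2) ^ 2 - ∑ i, s i ^ 4) := by
        gcongr
        exact sum_offDiag_mul_le s (h.card_le.trans hd)
    _ = _ := by
        rw [sum_sq, one_pow, pureConcurrence_eq h]
        field_simp

end PureState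

section MixedState

theorem IsDensityMatrix.exists_isEnsemble {S : Type*} [Fintype S] {ρ : Matrix S S ℂ}
    (hρ : IsDensityMatrix ρ) :
    ∃ (k : ℕ) (p : Fin k → ℝ) (φ : Fin k → EuclideanSpace ℂ S), IsEnsemble ρ p φ := by
  classical
  have hH := hρ.posSemidef.isHermitian
  let σ := Fintype.equivFin S
  refine ⟨Fintype.card S, fun i => hH.eigenvalues (σ.symm i),
    fun i => hH.eigenvectorBasis (σ.symm i), fun i => hρ.posSemidef.eigenvalues_nonneg _, ?_,
    fun i => hH.eigenvectorBasis.orthonormal.1 _, ?_⟩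
  · have trace_eq := hH.trace_eq_sum_eigenvalues
    rw [hρ.trace_eq_one] at trace_eq
    rw [σ.symm.sum_comp hH.eigenvalues]
    apply Complex.ofReal_injective
    simpa using trace_eq.symm
  · rw [σ.symm.sum_comp fun s => (hH.eigenvalues s : ℂ) • ketBra (hH.eigenvectorBasis s)]
    calc ρ = ∑ j, vecMulVec (ρ *ᵥ (hH.eigenvectorBasis j).ofLp)
            (star (hH.eigenvectorBasis j).ofLp) := by
          simp only [← mul_vecMulVec, ← Matrix.mul_sum, sum_vecMulVec_star_orthonormalBasis,
            Matrix.mul_one]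
      _ = _ := by
          simp only [hH.mulVec_eigenvectorBasis, smul_vecMulVec]
          rfl

variable {A B ι κ : Type*} [Fintype A] [Fintype B] {ρ : Matrix (A × B) (A × B) ℂ}

theorem le_concurrence (hρ : IsDensityMatrix ρ) {c : ℝ}
    (hc : ∀ (k : ℕ) (p : Fin k → ℝ) (φ : Fin k → EuclideanSpace ℂ (A × B)),
      IsEnsemble ρ p φ → c ≤ ∑ i, p i * pureConcurrence (φ i)) :
    c ≤ concurrence ρ := by
  obtain ⟨k, p, φ, h⟩ := hρ.exists_isEnsemble
  refine le_csInf ⟨_, k, p, φ, h, rfl⟩ ?_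
  rintro _ ⟨k, p, φ, h, rfl⟩
  exact hc k p φ h

theorem traceNorm_complexQ_le_of_isEnsemble [Fintype ι] [Fintype κ] [DecidableEq κ] [DecidableEq B]
    (w : EuclideanSpace ℂ ι) (z : EuclideanSpace ℂ κ) {k : ℕ} {p : Fin k → ℝ}
    {φ : Fin k → EuclideanSpace ℂ (A × B)} (h : IsEnsemble ρ p φ) {d : ℕ}
    (hd : min (Fintype.card A) (Fintype.card B) ≤ d) :
    traceNorm (complexQ w z ρ) ≤ √((‖w‖ ^ 2 + 1) * (‖z‖ ^ 2 + 1)) +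
      √(d * (d - 1)) / √2 * ∑ i, p i * pureConcurrence (φ i) := by
  have sum_p : ∑ i, (p i : ℂ) = 1 := by exact_mod_cast h.sum_eq_one
  rw [h.eq_sum, complexQ_sum_smul w z sum_p]
  calc _ ≤ ∑ i, p i * traceNorm (complexQ w z (ketBra (φ i))) := by
        simpa only [Complex.norm_of_nonneg (h.nonneg _)] using
          traceNorm_sum_smul_le Finset.univ (fun i => (p i : ℂ)) fun i =>
            complexQ w z (ketBra (φ i))
    _ ≤ ∑ i, p i * (√((‖w‖ ^ 2 + 1) * (‖z‖ ^ 2 + 1)) +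
          √(d * (d - 1)) / √2 * pureConcurrence (φ i)) :=
        Finset.sum_le_sum fun i _ => mul_le_mul_of_nonneg_left
          (traceNorm_complexQ_ketBra_le w z (h.norm_eq_one i) hd) (h.nonneg i)
    _ = _ := by
        simp only [mul_add, Finset.sum_add_distrib, ← Finset.sum_mul, h.sum_eq_one, one_mul,
          Finset.mul_sum, mul_left_comm]

theorem norm_toLp_toComplex {n : ℕ} (μ : EuclideanSpace ℝ (Fin n)) :
    ‖(WithLp.toLp 2 (toComplex μ) : EuclideanSpace ℂ (Fin n))‖ = ‖μ‖ := by
  simp [EuclideanSpace.norm_eq, toComplex]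

end MixedState

end BipartiteState

open BipartiteState in
theorem theorem2_general {A B ι κ : Type*} [Fintype A] [Fintype B] [DecidableEq B] [Fintype ι]
    [Fintype κ] [DecidableEq κ] (w : EuclideanSpace ℂ ι) (z : EuclideanSpace ℂ κ)
    {ρ : Matrix (A × B) (A × B) ℂ} (hρ : IsDensityMatrix ρ) {d : ℕ} (hd : 2 ≤ d)
    (hAB : min (Fintype.card A) (Fintype.card B) ≤ d) :
    √2 / √((d : ℝ) * ((d : ℝ) - 1)) *
        (traceNorm (complexQ w z ρ) - √((‖w‖ ^ 2 + 1) * (‖z‖ ^ 2 + 1)))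
      ≤ concurrence ρ := by
  refine le_concurrence hρ fun k p φ h => ?_
  have sqrt_pos : 0 < √((d : ℝ) * ((d : ℝ) - 1)) := by
    have : (2 : ℝ) ≤ d := by exact_mod_cast hd
    exact Real.sqrt_pos.mpr (by nlinarith)
  have bound := traceNorm_complexQ_le_of_isEnsemble w z h hAB
  rw [div_mul_eq_mul_div, div_le_iff₀ sqrt_pos]
  calc _ ≤ √2 * (√(d * (d - 1)) / √2 * ∑ i, p i * pureConcurrence (φ i)) := by
        gcongr
        exact sub_le_iff_le_add'.mpr bound
    _ = _ := by field_simp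

theorem theorem2 (dA dB n m : ℕ) (hA : 2 ≤ dA) (hB : 2 ≤ dB)
    (μ : EuclideanSpace ℝ (Fin n)) (ν : EuclideanSpace ℝ (Fin m))
    (ρ : Matrix (Fin dA × Fin dB) (Fin dA × Fin dB) ℂ)
    (hρ : BipartiteState.IsDensityMatrix ρ)
    (d : ℕ) (hd : d = min dA dB) :
    √2 / √((d : ℝ) * ((d : ℝ) - 1)) *
        (BipartiteState.traceNorm (BipartiteState.Q μ ν ρ)
          - √((‖μ‖ ^ 2 + 1) * (‖ν‖ ^ 2 + 1)))
      ≤ BipartiteState.concurrence ρ := by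
  have bound := theorem2_general (WithLp.toLp 2 (BipartiteState.toComplex μ))
    (WithLp.toLp 2 (BipartiteState.toComplex ν)) hρ (hd ▸ le_min hA hB) (by simp [hd])
  rwa [BipartiteState.norm_toLp_toComplex, BipartiteState.norm_toLp_toComplex] at bound
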